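/- Let $d$ be a natural number and let $G\le \mathrm{Sym}(d)$ act on $\mathbb R^d$ by permuting coordinates; identify $G$ with the corresponding group of permutation matrices in $\mathrm{GL}(d,\mathbb Z)$, and put $\mathrm{Fix}(G)=\{v\in\mathbb R^d : gv=v \text{ for all } g\in G\}$. A subspace of $\mathbb R^d$ is called rational if it has a basis contained in $\mathbb Q^d$. The group $G$ is called a QI-group if it is transitive on $\{1,\dots,d\}$ and $\mathrm{Fix}(G)^{\perp}$ contains no rational $G$-invariant subspace other than $\{0\}$ and $\mathrm{Fix}(G)^\perp$ itself (for $d\ge 2$: if $G$ is transitive and $\mathrm{Fix}(G)^{\perp}\cap\mathbb Q^d$ is a simple $\mathbb QG$-module). A point $z\in\mathbb Z^d$ is a core point for $G$ if $\mathrm{conv}(Gz)\cap\mathbb Z^d=Gz$. Two points $z,w\in\mathbb Z^d$ are normalizer equivalent if $w=Sz+b$ for some $S$ in the normalizer of $G$ in $\mathrm{GL}(d,\mathbb Z)$ and some $b\in\mathrm{Fix}(G)\cap\mathbb Z^d$. **Theorem 5.1.** Let $G\le \mathrm{Sym}(d)$ be a QI-group. Then there is a constant $M$, depending only on $G$, such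 that every core point $z$ for $G$ is normalizer equivalent to a core point $w$ for $G$ with $\|w\|^2\le M$ (Euclidean norm). In particular, there are only finitely many core points for $G$ up to normalizer equivalence. Moreover, if $d$ is prime, then every transitive group $G\le\mathrm{Sym}(d)$ is a QI-group, so that the above applies to it. -/

import Mathlib

/-- The integer vector `z`, viewed as a point of Euclidean space `ℝ^d`. -/
noncomputable def latticePoint {d : ℕ} (z : Fin d → ℤ) : EuclideanSpace ℝ (Fin d) :=
  WithLp.toLp 2 (fun i => (z i : ℝ))

/-- The lattice `Λ = ℤ^d` in `ℝ^d`. -/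
def integerLattice (d : ℕ) : Set (EuclideanSpace ℝ (Fin d)) :=
  Set.range (latticePoint (d := d))

/-- The linear map of `ℝ^d` given by a matrix in `GL(d, ℤ)`. -/
noncomputable def realAction {d : ℕ} (A : GL (Fin d) ℤ) :
    EuclideanSpace ℝ (Fin d) →ₗ[ℝ] EuclideanSpace ℝ (Fin d) :=
  Matrix.toEuclideanLin ((A : Matrix (Fin d) (Fin d) ℤ).map (fun n : ℤ => (n : ℝ)))

/-- The orbit `H v` of a point `v` of `ℝ^d`. -/
def pointOrbit {d : ℕ} (H : Subgroup (GL (Fin d) ℤ)) (v : EuclideanSpace ℝ (Fin d)) :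
    Set (EuclideanSpace ℝ (Fin d)) :=
  {x | ∃ A ∈ H, x = realAction A v}

/-- The orbit polytope `P(H, v)`: the convex hull of the orbit of `v`. -/
def orbitPolytope {d : ℕ} (H : Subgroup (GL (Fin d) ℤ)) (v : EuclideanSpace ℝ (Fin d)) :
    Set (EuclideanSpace ℝ (Fin d)) :=
  convexHull ℝ (pointOrbit H v)

/-- `z ∈ ℤ^d` is a core point for `H` if the only lattice points of its orbit polytope are the
points of the orbit of `z`. -/
def IsCorePoint {d : ℕ} (H : Subgroup (GL (Fin d) ℤ)) (z : Fin d → ℤ) : Prop :=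
  orbitPolytope H (latticePoint z) ∩ integerLattice d = pointOrbit H (latticePoint z)

/-- The fixed space `Fix(H)` of `H` in `ℝ^d`. -/
noncomputable def fixedSpace {d : ℕ} (H : Subgroup (GL (Fin d) ℤ)) :
    Submodule ℝ (EuclideanSpace ℝ (Fin d)) where
  carrier := {v | ∀ A ∈ H, realAction A v = v}
  add_mem' := by
    intro a b ha hb A hA
    rw [map_add, ha A hA, hb A hA]
  zero_mem' := by
    intro A _
    rw [map_zero]
  smul_mem' := by
    intro c x hx A hA
    rw [map_smul, hx A hA]

/-- Normalizer equivalence: `w = S z + b` with `S` in the normalizer of `H` in `GL(d, ℤ)` and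
`b` a lattice point fixed by `H`. -/
def NormalizerEquivalent {d : ℕ} (H : Subgroup (GL (Fin d) ℤ)) (z w : Fin d → ℤ) : Prop :=
  ∃ S ∈ Subgroup.normalizer (H : Set (GL (Fin d) ℤ)), ∃ b : Fin d → ℤ,
    latticePoint b ∈ fixedSpace H ∧
      w = Matrix.mulVec (S : Matrix (Fin d) (Fin d) ℤ) z + b

theorem latticePoint_injective {d : ℕ} : Function.Injective (latticePoint (d := d)) := by
  intro z w h
  funext i
  have h1 : ((z i : ℤ) : ℝ) = (w i : ℝ) := congrArg (fun v : EuclideanSpace ℝ (Fin d) => v i) h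
  exact_mod_cast h1

theorem realAction_latticePoint {d : ℕ} (A : GL (Fin d) ℤ) (z : Fin d → ℤ) :
    realAction A (latticePoint z) =
      latticePoint (Matrix.mulVec (A : Matrix (Fin d) (Fin d) ℤ) z) := by
  ext i
  simp [realAction, latticePoint, Matrix.mulVec, dotProduct]

theorem latticePoint_mem_fixedSpace {d : ℕ} (H : Subgroup (GL (Fin d) ℤ)) (b : Fin d → ℤ) :
    latticePoint b ∈ fixedSpace H ↔
      ∀ A ∈ H, Matrix.mulVec (A : Matrix (Fin d) (Fin d) ℤ) b = b := by
  constructor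
  · intro h A hA
    have h1 := h A hA
    rw [realAction_latticePoint] at h1
    exact latticePoint_injective h1
  · intro h A hA
    rw [realAction_latticePoint, h A hA]

/-- Elements of the normalizer preserve the set of fixed lattice points. -/
theorem mulVec_mem_fixedSpace {d : ℕ} (H : Subgroup (GL (Fin d) ℤ)) (S : GL (Fin d) ℤ)
    (hS : S ∈ Subgroup.normalizer (H : Set (GL (Fin d) ℤ))) (b : Fin d → ℤ)
    (hb : latticePoint b ∈ fixedSpace H) :
    latticePoint (Matrix.mulVec (S : Matrix (Fin d) (Fin d) ℤ) b) ∈ fixedSpace H := by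
  rw [latticePoint_mem_fixedSpace] at hb ⊢
  intro A hA
  have h1 : S⁻¹ * A * S ∈ H := (Subgroup.mem_normalizer_iff''.mp hS A).mp hA
  have h2 : A * S = S * (S⁻¹ * A * S) := by group
  rw [Matrix.mulVec_mulVec, ← Units.val_mul, h2, Units.val_mul, ← Matrix.mulVec_mulVec,
    hb _ h1]

theorem normalizerEquivalent_equivalence {d : ℕ} (H : Subgroup (GL (Fin d) ℤ)) :
    Equivalence (NormalizerEquivalent H) where
  refl z := by
    refine ⟨1, one_mem _, 0, ?_, ?_⟩
    · rw [latticePoint_mem_fixedSpace]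
      intro A _
      rw [Matrix.mulVec_zero]
    · simp
  symm := by
    rintro z w ⟨S, hS, b, hb, rfl⟩
    refine ⟨S⁻¹, inv_mem hS, -Matrix.mulVec ((S⁻¹ : GL (Fin d) ℤ) : Matrix _ _ ℤ) b, ?_, ?_⟩
    · have h := mulVec_mem_fixedSpace H S⁻¹ (inv_mem hS) b hb
      rw [latticePoint_mem_fixedSpace] at h ⊢
      intro A hA
      rw [Matrix.mulVec_neg, h A hA]
    · rw [Matrix.mulVec_add, Matrix.mulVec_mulVec, ← Units.val_mul, inv_mul_cancel,
        Units.val_one, Matrix.one_mulVec]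
      abel
  trans := by
    rintro z w x ⟨S, hS, b, hb, rfl⟩ ⟨T, hT, c, hc, rfl⟩
    refine ⟨T * S, mul_mem hT hS, Matrix.mulVec (T : Matrix (Fin d) (Fin d) ℤ) b + c, ?_, ?_⟩
    · have h := mulVec_mem_fixedSpace H T hT b hb
      rw [latticePoint_mem_fixedSpace] at h hc ⊢
      intro A hA
      rw [Matrix.mulVec_add, h A hA, hc A hA]
    · rw [Matrix.mulVec_add, Matrix.mulVec_mulVec, Units.val_mul, add_assoc]

/-- Normalizer equivalence as an equivalence relation on the set of core points for `H`. -/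
def corePointSetoid {d : ℕ} (H : Subgroup (GL (Fin d) ℤ)) :
    Setoid {z : Fin d → ℤ // IsCorePoint H z} where
  r z w := NormalizerEquivalent H z.1 w.1
  iseqv :=
    ⟨fun z => (normalizerEquivalent_equivalence H).refl z.1,
      fun h => (normalizerEquivalent_equivalence H).symm h,
      fun h h' => (normalizerEquivalent_equivalence H).trans h h'⟩

/-- A permutation group `G ≤ Sym(d)` as a group of permutation matrices in `GL(d, ℤ)`; it acts
by permuting coordinates, `(σ z) i = z (σ⁻¹ i)`. -/
noncomputable def permutationMatrices {d : ℕ} (G : Subgroup (Equiv.Perm (Fin d))) :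
    Subgroup (GL (Fin d) ℤ) :=
  G.map (Matrix.permMatrixHom (n := Fin d) (R := ℤ)).toHomUnits

/-- A subspace `U` of `ℝ^d` is rational if it has a basis contained in `ℚ^d`. -/
def IsRationalSubspace {d : ℕ} (U : Submodule ℝ (EuclideanSpace ℝ (Fin d))) : Prop :=
  ∃ s : Set (EuclideanSpace ℝ (Fin d)),
    LinearIndepOn ℝ id s ∧ Submodule.span ℝ s = U ∧ ∀ v ∈ s, ∀ i, ∃ q : ℚ, v i = (q : ℝ)

/-- A subspace of `ℝ^d` is `H`-invariant if every element of `H` maps it into itself. -/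
def IsInvariantSubspace {d : ℕ} (H : Subgroup (GL (Fin d) ℤ))
    (U : Submodule ℝ (EuclideanSpace ℝ (Fin d))) : Prop :=
  ∀ A ∈ H, ∀ v ∈ U, realAction A v ∈ U

/-- A QI-group is a transitive permutation group `G ≤ Sym(d)` such that `Fix(G)ᗮ` contains no
rational `G`-invariant subspace other than `{0}` and `Fix(G)ᗮ` itself. -/
def IsQIGroup {d : ℕ} (G : Subgroup (Equiv.Perm (Fin d))) : Prop :=
  MulAction.IsPretransitive G (Fin d) ∧
    ∀ U : Submodule ℝ (EuclideanSpace ℝ (Fin d)),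
      U ≤ (fixedSpace (permutationMatrices G))ᗮ → IsRationalSubspace U →
        IsInvariantSubspace (permutationMatrices G) U →
          U = ⊥ ∨ U = (fixedSpace (permutationMatrices G))ᗮ

/-! Constant points form a single class, so let `z` be a nonconstant core point. Translating by a
constant vector brings its coordinate sum `s` into `[1, d]`. The QI condition then makes the orbit
of `z` span `ℝ^d`, and `d` orbit points are chosen as a basis with determinant `D` of maximal
absolute value; by Cramer's rule all orbit points have coordinates at most 1 in absolute value in
this basis.

The key point is that `|D|` is bounded in terms of `G` (`abs_det_orbitMatrix_lt`). If `|D|` were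
large, Minkowski's theorem would give a nonzero integer vector `v` with tiny coordinates in the
basis. As its coordinate sum is an integer of absolute value below 1, it is zero, so by the QI
condition the orbit of `v` spans the sum-zero hyperplane. Subtracting integer multiples of the
vectors `g v` from `z` yields a lattice point `y` very close to the centroid of the orbit, hence
inside the orbit polytope. Since `z` is a core point, `y` lies in the orbit, so every orbit point is
close to the centroid in these coordinates. This is absurd for two distinct basis vectors.

With `|D|` bounded, only finitely many data (choice of basis, `D`, residues mod `D`, Cramer
coefficients) occur. Two points with equal data are related by an integral matrix of determinant 1
commuting with `G` (`normalizerEquivalent_of_orbitMatrix`). Finiteness of the set of classes then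
gives `M` by choosing representatives.

For prime `d`, a transitive group contains a `d`-cycle, and irreducibility of the cyclotomic
polynomial over `ℚ` excludes proper rational invariant subspaces. -/

/-! ### Permutation action and the sum-zero hyperplane. -/

/-- The permutation matrix of `σ`, as an element of `GL(d, ℤ)`. -/
noncomputable def permGL {d : ℕ} (σ : Equiv.Perm (Fin d)) : GL (Fin d) ℤ :=
  (Matrix.permMatrixHom (n := Fin d) (R := ℤ)).toHomUnits σ

theorem permGL_mem {d : ℕ} {G : Subgroup (Equiv.Perm (Fin d))} (g : G) :
    permGL (g : Equiv.Perm (Fin d)) ∈ permutationMatrices G :=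
  Subgroup.mem_map_of_mem _ g.2

theorem mem_permutationMatrices_iff {d : ℕ} {G : Subgroup (Equiv.Perm (Fin d))}
    {A : GL (Fin d) ℤ} : A ∈ permutationMatrices G ↔ ∃ g : G, permGL (g : Equiv.Perm (Fin d)) = A :=
  ⟨fun ⟨σ, hσ, h⟩ => ⟨⟨σ, hσ⟩, h⟩, fun ⟨g, h⟩ => h ▸ permGL_mem g⟩

theorem permGL_mulVec {d : ℕ} (σ : Equiv.Perm (Fin d)) (z : Fin d → ℤ) :
    Matrix.mulVec (permGL σ : Matrix (Fin d) (Fin d) ℤ) z = z ∘ ⇑σ⁻¹ := by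
  simp [permGL, Matrix.permMatrix_mulVec]

theorem realAction_permGL {d : ℕ} (σ : Equiv.Perm (Fin d)) (v : EuclideanSpace ℝ (Fin d)) :
    realAction (permGL σ) v = WithLp.toLp 2 (v.ofLp ∘ ⇑σ⁻¹) := by
  have h : ((permGL σ : Matrix (Fin d) (Fin d) ℤ).map (fun n : ℤ => (n : ℝ))) =
      σ⁻¹.permMatrix ℝ := by
    ext i j
    simp [permGL, Equiv.Perm.permMatrix, PEquiv.toMatrix_apply]
  ext i
  rw [realAction, h, Matrix.toLpLin_apply, Matrix.permMatrix_mulVec]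

theorem mem_fixedSpace_iff_of_isPretransitive {d : ℕ} {G : Subgroup (Equiv.Perm (Fin d))}
    (hG : MulAction.IsPretransitive G (Fin d)) (v : EuclideanSpace ℝ (Fin d)) :
    v ∈ fixedSpace (permutationMatrices G) ↔ ∀ i j, v i = v j := by
  constructor
  · intro h i j
    obtain ⟨g, rfl⟩ := MulAction.exists_smul_eq G i j
    have h1 := h _ (permGL_mem g)
    rw [realAction_permGL] at h1
    have h2 := congrArg (fun w : EuclideanSpace ℝ (Fin d) => w (g • i)) h1
    simpa [Subgroup.smul_def] using h2
  · rintro h A hA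
    obtain ⟨g, rfl⟩ := mem_permutationMatrices_iff.1 hA
    rw [realAction_permGL]
    ext i
    exact h _ _

theorem mem_orthogonal_fixedSpace_iff {d : ℕ} {G : Subgroup (Equiv.Perm (Fin d))}
    (hG : MulAction.IsPretransitive G (Fin d)) (v : EuclideanSpace ℝ (Fin d)) :
    v ∈ (fixedSpace (permutationMatrices G))ᗮ ↔ ∑ i, v i = 0 := by
  rw [Submodule.mem_orthogonal]
  constructor
  · intro h
    have h1 := h (WithLp.toLp 2 fun _ => 1)
      ((mem_fixedSpace_iff_of_isPretransitive hG _).2 fun _ _ => rfl)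
    simpa [PiLp.inner_apply] using h1
  · intro h u hu
    rw [mem_fixedSpace_iff_of_isPretransitive hG] at hu
    rw [PiLp.inner_apply]
    rcases isEmpty_or_nonempty (Fin d) with he | ⟨⟨i₀⟩⟩
    · simp
    · calc ∑ i, inner ℝ (u i) (v i) = ∑ i, u i₀ * v i :=
            Finset.sum_congr rfl fun i _ => by rw [hu i i₀]; simp [mul_comm]
        _ = 0 := by rw [← Finset.mul_sum, h, mul_zero]

theorem sum_comp_perm_inv {d : ℕ} {R : Type*} [AddCommMonoid R] (σ : Equiv.Perm (Fin d))
    (v : Fin d → R) : ∑ i, (v ∘ ⇑σ⁻¹) i = ∑ i, v i :=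
  Equiv.sum_comp σ⁻¹ v

/-- For a QI-group, the orbit of a nonzero lattice vector with coordinate sum zero spans the space
of all vectors with coordinate sum zero. -/
theorem IsQIGroup.exists_eq_sum_orbit {d : ℕ} {G : Subgroup (Equiv.Perm (Fin d))} [Fintype G]
    (hG : IsQIGroup G) {v : Fin d → ℤ} (hv : v ≠ 0) (hv0 : ∑ i, v i = 0)
    (w : Fin d → ℝ) (hw : ∑ i, w i = 0) :
    ∃ t : G → ℝ, ∀ i, w i = ∑ g : G, t g * v ((g : Equiv.Perm (Fin d))⁻¹ i) := by
  set x : G → EuclideanSpace ℝ (Fin d) :=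
    fun g => latticePoint (v ∘ ⇑(g : Equiv.Perm (Fin d))⁻¹) with hx
  set U := Submodule.span ℝ (Set.range x) with hU
  have hle : U ≤ (fixedSpace (permutationMatrices G))ᗮ := by
    rw [hU, Submodule.span_le]
    rintro _ ⟨g, rfl⟩
    rw [SetLike.mem_coe, mem_orthogonal_fixedSpace_iff hG.1]
    have := sum_comp_perm_inv (g : Equiv.Perm (Fin d)) v
    rw [hv0] at this
    simp only [hx, latticePoint]
    exact_mod_cast this
  have hrat : IsRationalSubspace U := by
    -- A basis extracted from the orbit itself consists of integer vectors.
    obtain ⟨b, hb, hspan, hli⟩ := exists_linearIndependent ℝ (Set.range x)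
    refine ⟨b, hli, hspan, ?_⟩
    intro u hu i
    obtain ⟨g, rfl⟩ := hb hu
    exact ⟨((v ∘ ⇑(g : Equiv.Perm (Fin d))⁻¹) i : ℤ), by simp [hx, latticePoint]⟩
  have hinv : IsInvariantSubspace (permutationMatrices G) U := by
    intro A hA u hu
    obtain ⟨h, rfl⟩ := mem_permutationMatrices_iff.1 hA
    have : U ≤ U.comap (realAction (permGL (h : Equiv.Perm (Fin d)))) := by
      conv_lhs => rw [hU]
      rw [Submodule.span_le]
      rintro _ ⟨g, rfl⟩
      refine Submodule.subset_span ⟨h * g, ?_⟩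
      simp only [hx, realAction_latticePoint, permGL_mulVec]
      congr 1
    exact this hu
  have hUW : U = (fixedSpace (permutationMatrices G))ᗮ := by
    refine (hG.2 U hle hrat hinv).resolve_left fun hbot => hv ?_
    have h1 : x 1 ∈ U := Submodule.subset_span ⟨1, rfl⟩
    rw [hbot, Submodule.mem_bot] at h1
    refine latticePoint_injective ?_
    have h0 : latticePoint (0 : Fin d → ℤ) = 0 := by ext i; simp [latticePoint]
    rw [h0, ← h1]
    simp only [hx]
    rfl
  have hwU : WithLp.toLp 2 w ∈ U := by
    rw [hUW, mem_orthogonal_fixedSpace_iff hG.1]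
    exact hw
  rw [hU, Submodule.mem_span_range_iff_exists_fun] at hwU
  obtain ⟨t, ht⟩ := hwU
  refine ⟨t, fun i => ?_⟩
  have := congrArg (fun u : EuclideanSpace ℝ (Fin d) => u i) ht
  simp only at this
  rw [← this]
  simp [hx, latticePoint]

/-! ### Core points in terms of convex weights indexed by the group. -/

/-- Every lattice point that is a convex combination of the orbit of `z` lies in the orbit. -/
def HasOnlyOrbitPoints {d : ℕ} (G : Subgroup (Equiv.Perm (Fin d))) [Fintype G]
    (z : Fin d → ℤ) : Prop :=
  ∀ (y : Fin d → ℤ) (c : G → ℝ), (∀ g, 0 ≤ c g) → ∑ g, c g = 1 →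
    (∀ i, (y i : ℝ) = ∑ g : G, c g * z ((g : Equiv.Perm (Fin d))⁻¹ i)) →
      ∃ g : G, y = z ∘ ⇑(g : Equiv.Perm (Fin d))⁻¹

theorem IsCorePoint.hasOnlyOrbitPoints {d : ℕ} {G : Subgroup (Equiv.Perm (Fin d))} [Fintype G]
    {z : Fin d → ℤ} (hz : IsCorePoint (permutationMatrices G) z) : HasOnlyOrbitPoints G z := by
  intro y c hc hc1 hy
  have hmem : latticePoint y ∈ orbitPolytope (permutationMatrices G) (latticePoint z) := by
    have h1 : latticePoint y =
        ∑ g : G, c g • latticePoint (z ∘ ⇑(g : Equiv.Perm (Fin d))⁻¹) := by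
      ext i
      simpa [latticePoint] using hy i
    rw [h1]
    refine (convex_convexHull ℝ _).sum_mem (fun g _ => hc g) hc1 fun g _ => ?_
    refine subset_convexHull ℝ _ ⟨_, permGL_mem g, ?_⟩
    rw [realAction_latticePoint, permGL_mulVec]
  have h2 : latticePoint y ∈ pointOrbit (permutationMatrices G) (latticePoint z) := by
    rw [← hz]
    exact ⟨hmem, y, rfl⟩
  obtain ⟨A, hA, hyA⟩ := h2
  obtain ⟨g, rfl⟩ := mem_permutationMatrices_iff.1 hA
  rw [realAction_latticePoint, permGL_mulVec] at hyA
  exact ⟨g, latticePoint_injective hyA⟩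

theorem HasOnlyOrbitPoints.add_const {d : ℕ} {G : Subgroup (Equiv.Perm (Fin d))} [Fintype G]
    {z : Fin d → ℤ} (hz : HasOnlyOrbitPoints G z) (t : ℤ) :
    HasOnlyOrbitPoints G (fun i => z i + t) := by
  intro y c hc hc1 hy
  obtain ⟨g, hg⟩ := hz (fun i => y i - t) c hc hc1 fun i => by
    push_cast
    rw [hy i]
    push_cast
    simp only [mul_add, Finset.sum_add_distrib, ← Finset.sum_mul, hc1]
    ring
  refine ⟨g, funext fun i => ?_⟩
  have := congrFun hg i
  simp only [Function.comp_apply] at this ⊢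
  linarith

/-! ### Geometry of numbers. -/

open MeasureTheory in
/-- Minkowski's linear forms theorem. -/
theorem exists_int_vector_ne_zero_of_det {d : ℕ} (hd : 0 < d) (A : Matrix (Fin d) (Fin d) ℝ)
    {ε : ℝ} (hε : 0 ≤ ε) (h : 1 ≤ ε ^ d * |A.det|) :
    ∃ v : Fin d → ℤ, v ≠ 0 ∧ ∃ x : Fin d → ℝ, (∀ j, |x j| ≤ ε) ∧
      (fun i => (v i : ℝ)) = A.mulVec x := by
  have : Nonempty (Fin d) := ⟨⟨0, hd⟩⟩
  set s : Set (Fin d → ℝ) := Matrix.toLin' A '' Metric.closedBall 0 ε with hs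
  set b := Pi.basisFun ℝ (Fin d)
  have hvol : volume (ZSpan.fundamentalDomain b) *
      2 ^ Module.finrank ℝ (Fin d → ℝ) ≤ volume s := by
    rw [hs, Measure.addHaar_image_linearMap, LinearMap.det_toLin',
      Real.volume_pi_closedBall _ hε, ZSpan.fundamentalDomain_pi_basisFun, volume_pi_pi]
    simp only [Real.volume_Ico, sub_zero, ENNReal.ofReal_one, Finset.prod_const_one, one_mul,
      Module.finrank_fintype_fun_eq_card, Fintype.card_fin]
    rw [← ENNReal.ofReal_mul (abs_nonneg _), show (2 : ENNReal) ^ d = ENNReal.ofReal (2 ^ d) by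
      rw [ENNReal.ofReal_pow (by norm_num)]; norm_num]
    refine ENNReal.ofReal_le_ofReal ?_
    rw [mul_pow]
    nlinarith [pow_pos (show (0 : ℝ) < 2 by norm_num) d]
  have : Countable (Submodule.span ℤ (Set.range b)).toAddSubgroup := by
    change Countable (Submodule.span ℤ (Set.range b))
    infer_instance
  have : DiscreteTopology (Submodule.span ℤ (Set.range b)).toAddSubgroup := by
    change DiscreteTopology (Submodule.span ℤ (Set.range b))
    infer_instance
  -- The image of the closed cube is compact, so equality in the volume bound is allowed.
  obtain ⟨⟨u, hu⟩, hu0, hus⟩ := exists_ne_zero_mem_lattice_of_measure_mul_two_pow_le_measure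
    (ZSpan.isAddFundamentalDomain' b volume) (s := s)
    (by
      rintro _ ⟨x, hx, rfl⟩
      exact ⟨-x, by simpa using hx, map_neg _ _⟩)
    ((convex_closedBall 0 ε).linear_image _)
    ((isCompact_closedBall 0 ε).image
      (LinearMap.continuous_of_finiteDimensional (Matrix.toLin' A))) hvol
  rw [Submodule.mem_toAddSubgroup, b.mem_span_iff_repr_mem ℤ] at hu
  choose v hv using hu
  have hv' : (fun i => (v i : ℝ)) = u := funext fun i => by simpa [b] using hv i
  obtain ⟨x, hx, hxu⟩ := hus
  refine ⟨v, ?_, x, fun j => ?_, ?_⟩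
  · rintro rfl
    refine hu0 (Subtype.ext ?_)
    refine Eq.trans (show u = 0 from ?_) rfl
    rw [← hv']
    ext i
    simp
  · rw [mem_closedBall_zero_iff] at hx
    exact (norm_le_pi_norm x j).trans hx
  · rw [hv', ← Matrix.toLin'_apply, hxu]

/-! ### Orbit matrices and coordinates in a basis of orbit points. -/

/-- The matrix whose columns are the points `γ j • z` of the orbit of `z`. -/
def orbitMatrix {d : ℕ} {G : Subgroup (Equiv.Perm (Fin d))} (z : Fin d → ℤ) (γ : Fin d → G) :
    Matrix (Fin d) (Fin d) ℤ :=
  Matrix.of fun i j => z ((γ j : Equiv.Perm (Fin d))⁻¹ i)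

/-- Replacing a column by an orbit point gives another orbit matrix, so a maximal determinant also
bounds every Cramer numerator. -/
theorem cramer_orbitMatrix {d : ℕ} {G : Subgroup (Equiv.Perm (Fin d))} (z : Fin d → ℤ)
    (γ : Fin d → G) (g : G) (j : Fin d) :
    (orbitMatrix z γ).cramer (z ∘ ⇑(g : Equiv.Perm (Fin d))⁻¹) j =
      (orbitMatrix z (Function.update γ j g)).det := by
  rw [Matrix.cramer_apply]
  congr 1
  ext i k
  by_cases h : k = j
  · subst h
    simp [orbitMatrix]
  · simp [orbitMatrix, h]

section BoundedCoords

variable {d : ℕ}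

/-- `v` is a linear combination of the family `b` with coefficients of absolute value at
most `r`. -/
def HasBoundedCoords (b : Fin d → Fin d → ℝ) (r : ℝ) (v : Fin d → ℝ) : Prop :=
  ∃ x : Fin d → ℝ, (∀ j, |x j| ≤ r) ∧ ∀ i, v i = ∑ j, x j * b j i

theorem HasBoundedCoords.sum {b : Fin d → Fin d → ℝ} {r : ℝ} {ι : Type*} [Fintype ι]
    {v : ι → Fin d → ℝ} (hv : ∀ k, HasBoundedCoords b r (v k)) {t : ι → ℝ}
    (ht : ∀ k, |t k| ≤ 1) :
    HasBoundedCoords b (Fintype.card ι * r) (fun i => ∑ k, t k * v k i) := by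
  choose x hx hvx using hv
  refine ⟨fun j => ∑ k, t k * x k j, fun j => ?_, fun i => ?_⟩
  · calc |∑ k, t k * x k j| ≤ ∑ k, |t k * x k j| := Finset.abs_sum_le_sum_abs _ _
      _ ≤ ∑ _k : ι, r := Finset.sum_le_sum fun k _ => by
        rw [abs_mul]
        have := abs_nonneg (x k j)
        nlinarith [hx k j, ht k, abs_nonneg (t k)]
      _ = Fintype.card ι * r := by simp
  · simp only [hvx, Finset.mul_sum, Finset.sum_mul]
    rw [Finset.sum_comm]
    simp only [mul_assoc]

end BoundedCoords

/-! ### Bound on the maximal determinant of orbit points. -/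

section DetBound

variable {d : ℕ} {G : Subgroup (Equiv.Perm (Fin d))} {z : Fin d → ℤ} {γ : Fin d → G}

theorem hasBoundedCoords_orbit (hdet : (orbitMatrix z γ).det ≠ 0)
    (hmax : ∀ γ' : Fin d → G, |(orbitMatrix z γ').det| ≤ |(orbitMatrix z γ).det|) (g : G) :
    HasBoundedCoords (fun j i => (z ((γ j : Equiv.Perm (Fin d))⁻¹ i) : ℝ)) 1
      (fun i => (z ((g : Equiv.Perm (Fin d))⁻¹ i) : ℝ)) := by
  have hD : ((orbitMatrix z γ).det : ℝ) ≠ 0 := by exact_mod_cast hdet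
  refine ⟨fun j => ((orbitMatrix z γ).cramer (z ∘ ⇑(g : Equiv.Perm (Fin d))⁻¹) j : ℝ) /
    (orbitMatrix z γ).det, fun j => ?_, fun i => ?_⟩
  · beta_reduce
    rw [cramer_orbitMatrix, abs_div, div_le_one (abs_pos.2 hD)]
    exact_mod_cast hmax _
  · have h := congrFun (Matrix.mulVec_cramer (orbitMatrix z γ)
      (z ∘ ⇑(g : Equiv.Perm (Fin d))⁻¹)) i
    simp only [Matrix.mulVec, dotProduct, Pi.smul_apply, smul_eq_mul, Function.comp_apply] at h
    have h' : (∑ j, (orbitMatrix z γ i j : ℝ) *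
        ((orbitMatrix z γ).cramer (z ∘ ⇑(g : Equiv.Perm (Fin d))⁻¹) j : ℝ)) =
        (orbitMatrix z γ).det * z ((g : Equiv.Perm (Fin d))⁻¹ i) := by exact_mod_cast h
    rw [eq_comm, ← mul_right_inj' hD, ← h', Finset.mul_sum]
    refine Finset.sum_congr rfl fun j _ => ?_
    have hA : orbitMatrix z γ i j = z ((γ j : Equiv.Perm (Fin d))⁻¹ i) := rfl
    rw [hA]
    field_simp

/-- The group moves each basis vector to an orbit point, whose coordinates are at most 1 in absolute
value; summing `d` such contributions costs the factor `d`. -/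
theorem HasBoundedCoords.comp_perm_inv (hdet : (orbitMatrix z γ).det ≠ 0)
    (hmax : ∀ γ' : Fin d → G, |(orbitMatrix z γ').det| ≤ |(orbitMatrix z γ).det|)
    {r : ℝ} (hr : 0 ≤ r) {v : Fin d → ℝ}
    (hv : HasBoundedCoords (fun j i => (z ((γ j : Equiv.Perm (Fin d))⁻¹ i) : ℝ)) r v) (h : G) :
    HasBoundedCoords (fun j i => (z ((γ j : Equiv.Perm (Fin d))⁻¹ i) : ℝ)) (d * r)
      (fun i => v ((h : Equiv.Perm (Fin d))⁻¹ i)) := by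
  obtain ⟨x, hx, hvx⟩ := hv
  choose a ha hza using fun j => hasBoundedCoords_orbit hdet hmax (h * γ j)
  refine ⟨fun k => ∑ j, x j * a j k, fun k => ?_, fun i => ?_⟩
  · calc |∑ j, x j * a j k| ≤ ∑ j, |x j * a j k| := Finset.abs_sum_le_sum_abs _ _
      _ ≤ ∑ _j : Fin d, r := Finset.sum_le_sum fun j _ => by
        rw [abs_mul]
        nlinarith [hx j, ha j k, abs_nonneg (a j k), abs_nonneg (x j)]
      _ = d * r := by simp
  · have h1 : ∀ j, (z ((γ j : Equiv.Perm (Fin d))⁻¹ ((h : Equiv.Perm (Fin d))⁻¹ i)) : ℝ) =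
        ∑ k, a j k * z ((γ k : Equiv.Perm (Fin d))⁻¹ i) := fun j => by
      rw [← hza j i]
      simp
    simp only [hvx, h1, Finset.mul_sum, Finset.sum_mul]
    rw [Finset.sum_comm]
    simp only [mul_assoc]

theorem eq_of_sum_mul_orbit_eq (hdet : (orbitMatrix z γ).det ≠ 0) {x x' : Fin d → ℝ}
    (h : ∀ i, ∑ j, x j * (z ((γ j : Equiv.Perm (Fin d))⁻¹ i) : ℝ) =
      ∑ j, x' j * (z ((γ j : Equiv.Perm (Fin d))⁻¹ i) : ℝ)) : x = x' := by
  set A := (orbitMatrix z γ).map (Int.castRingHom ℝ) with hA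
  have hA0 : A.det ≠ 0 := by
    rw [hA, ← RingHom.mapMatrix_apply, ← RingHom.map_det]
    simpa using hdet
  refine Matrix.mulVec_injective_of_isUnit ((Matrix.isUnit_iff_isUnit_det A).2 hA0.isUnit) ?_
  funext i
  simpa [Matrix.mulVec, dotProduct, hA, orbitMatrix, mul_comm] using h i

variable [Fintype G]

/-- By transitivity the sum over the orbit is a constant vector, and its coordinate sum determines
it. Hence the centroid has all coordinates `s / d`. -/
theorem sum_orbit_eq_average (hG : MulAction.IsPretransitive G (Fin d)) (z : Fin d → ℤ)
    (i : Fin d) :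
    (d : ℝ) * ∑ g : G, (z ((g : Equiv.Perm (Fin d))⁻¹ i) : ℝ) =
      Fintype.card G * ∑ k, (z k : ℝ) := by
  have hconst : ∀ k, ∑ g : G, (z ((g : Equiv.Perm (Fin d))⁻¹ k) : ℝ) =
      ∑ g : G, (z ((g : Equiv.Perm (Fin d))⁻¹ i) : ℝ) := by
    intro k
    obtain ⟨h, rfl⟩ := MulAction.exists_smul_eq G i k
    rw [← Equiv.sum_comp (Equiv.mulLeft h)]
    refine Finset.sum_congr rfl fun g _ => ?_
    simp [Subgroup.smul_def]
  calc (d : ℝ) * ∑ g : G, (z ((g : Equiv.Perm (Fin d))⁻¹ i) : ℝ)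
      = ∑ k, ∑ g : G, (z ((g : Equiv.Perm (Fin d))⁻¹ k) : ℝ) := by
        rw [Finset.sum_congr rfl fun k _ => hconst k]
        simp
    _ = ∑ g : G, ∑ k, (z k : ℝ) := by
        rw [Finset.sum_comm]
        exact Finset.sum_congr rfl fun g _ =>
          sum_comp_perm_inv (g : Equiv.Perm (Fin d)) fun k => (z k : ℝ)
    _ = _ := by simp

/-- For a core point with coordinate sum between `1` and `d`, the maximal determinant spanned by
points of its orbit is bounded. -/
theorem abs_det_orbitMatrix_lt (hG : IsQIGroup G) (hd : 2 ≤ d) (hz : HasOnlyOrbitPoints G z)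
    (hs1 : 1 ≤ ∑ i, z i) (hsd : ∑ i, z i ≤ d) (hdet : (orbitMatrix z γ).det ≠ 0)
    (hmax : ∀ γ' : Fin d → G, |(orbitMatrix z γ').det| ≤ |(orbitMatrix z γ).det|) :
    (|(orbitMatrix z γ).det| : ℝ) < (4 * (d : ℝ) ^ 2 * (Fintype.card G : ℝ) ^ 2) ^ d := by
  by_contra! hlarge
  set b : Fin d → Fin d → ℝ := fun j i => (z ((γ j : Equiv.Perm (Fin d))⁻¹ i) : ℝ) with hb
  set s : ℝ := ∑ i, (z i : ℝ) with hs
  have hs1' : 1 ≤ s := by rw [hs]; exact_mod_cast hs1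
  have hsd' : s ≤ d := by rw [hs]; exact_mod_cast hsd
  have hbs : ∀ j, ∑ i, b j i = s := fun j =>
    sum_comp_perm_inv (γ j : Equiv.Perm (Fin d)) fun k => (z k : ℝ)
  have hsum : ∀ x : Fin d → ℝ, ∑ i, ∑ j, x j * b j i = s * ∑ j, x j := fun x => by
    rw [Finset.sum_comm]
    simp only [← Finset.mul_sum, hbs]
    rw [← Finset.sum_mul, mul_comm]
  set N : ℝ := (Fintype.card G : ℝ) with hN
  have hN1 : 1 ≤ N := by
    rw [hN]
    exact_mod_cast Fintype.card_pos
  have hd2 : (2 : ℝ) ≤ d := by exact_mod_cast hd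
  -- With `ε = 1 / C`, the quantity `d * (N * (d * ε))` used below equals `1 / (4N)`: at most `1 /
  -- N` for nonnegative weights, at most `1 / 4` for the final contradiction.
  set C : ℝ := 4 * (d : ℝ) ^ 2 * N ^ 2 with hC
  have hCpos : 0 < C := by positivity
  set ε : ℝ := 1 / C with hε
  have hεpos : 0 < ε := by positivity
  have hεC : 4 * (d : ℝ) ^ 2 * N ^ 2 * ε = 1 := by
    rw [hε, ← hC]
    field_simp
  obtain ⟨v, hv0, x, hx, hvx⟩ := exists_int_vector_ne_zero_of_det (by omega : 0 < d)
    ((orbitMatrix z γ).map (Int.castRingHom ℝ)) hεpos.le (by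
      rw [← RingHom.mapMatrix_apply, ← RingHom.map_det, hε, div_pow, one_pow, one_div,
        eq_intCast, ← div_eq_inv_mul, one_le_div (by positivity)]
      exact hlarge)
  have hvb : ∀ i, (v i : ℝ) = ∑ j, x j * b j i := fun i => by
    have := congrFun hvx i
    simpa [Matrix.mulVec, dotProduct, orbitMatrix, mul_comm, hb] using this
  have hvcoord : HasBoundedCoords b ε (fun i => (v i : ℝ)) := ⟨x, hx, hvb⟩
  have hv_sum : ∑ i, v i = 0 := by
    have h1 : ((∑ i, v i : ℤ) : ℝ) = s * ∑ j, x j := by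
      push_cast
      rw [← hsum, Finset.sum_congr rfl fun i _ => hvb i]
    have h2 : |∑ j, x j| ≤ d * ε :=
      (Finset.abs_sum_le_sum_abs _ _).trans
        ((Finset.sum_le_sum fun j _ => hx j).trans (by simp))
    have h3 : |((∑ i, v i : ℤ) : ℝ)| < 1 := by
      rw [h1, abs_mul, abs_of_nonneg (by linarith : 0 ≤ s)]
      calc s * |∑ j, x j| ≤ d * (d * ε) := by gcongr
        _ = (d ^ 2 * ε) * 1 := by ring
        _ ≤ (d ^ 2 * ε) * N ^ 2 := by gcongr; nlinarith
        _ < 1 := by nlinarith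
    have h4 : |∑ i, v i| < 1 := by exact_mod_cast h3
    exact Int.abs_lt_one_iff.1 h4
  obtain ⟨t, ht⟩ := hG.exists_eq_sum_orbit hv0 hv_sum (fun i => z i - s / d) (by
    rw [Finset.sum_sub_distrib, ← hs]
    simp only [Finset.sum_const, Finset.card_univ, Fintype.card_fin, nsmul_eq_mul]
    field_simp
    ring)
  -- Rounding the coefficients keeps `y` integral and leaves only fractional parts between `y` and
  -- the centroid.
  set y : Fin d → ℤ := fun i => z i - ∑ g : G, ⌊t g⌋ * v ((g : Equiv.Perm (Fin d))⁻¹ i) with hy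
  have hyt : ∀ i, (y i : ℝ) - s / d =
      ∑ g : G, Int.fract (t g) * v ((g : Equiv.Perm (Fin d))⁻¹ i) := fun i => by
    simp only [Int.fract, sub_mul, Finset.sum_sub_distrib, ← ht i, hy]
    push_cast
    ring
  obtain ⟨x', hx', hyx'⟩ : HasBoundedCoords b (N * (d * ε)) (fun i => (y i : ℝ) - s / d) := by
    simp only [hyt]
    exact HasBoundedCoords.sum (fun g => hvcoord.comp_perm_inv hdet hmax hεpos.le g)
      fun g => by rw [abs_of_nonneg (Int.fract_nonneg _)]; exact (Int.fract_lt_one _).le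
  -- This makes the perturbed convex weights below still sum to 1.
  have hx'0 : ∑ j, x' j = 0 := by
    have h1 : s * ∑ j, x' j = 0 := by
      rw [← hsum, ← Finset.sum_congr rfl fun i _ => hyx' i, Finset.sum_congr rfl fun i _ => hyt i,
        Finset.sum_comm]
      refine Finset.sum_eq_zero fun g _ => ?_
      rw [← Finset.mul_sum]
      have := sum_comp_perm_inv (g : Equiv.Perm (Fin d)) v
      rw [hv_sum] at this
      have h2 : ∑ i, (v ((g : Equiv.Perm (Fin d))⁻¹ i) : ℝ) = 0 := by exact_mod_cast this
      rw [h2, mul_zero]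
    exact (mul_eq_zero.1 h1).resolve_left (by linarith)
  have havg : ∀ i, ∑ g : G, 1 / N * (z ((g : Equiv.Perm (Fin d))⁻¹ i) : ℝ) = s / d := fun i => by
    have := sum_orbit_eq_average hG.1 z i
    rw [← Finset.mul_sum]
    field_simp
    linarith
  classical
  -- Uniform weights give the centroid; adding `x' j` to the weight of `γ j` moves it to `y`.
  obtain ⟨g, hg⟩ := hz y (fun g => 1 / N + ∑ j, if γ j = g then x' j else 0)
    (fun g => by
      have h1 : |∑ j, if γ j = g then x' j else 0| ≤ d * (N * (d * ε)) :=
        (Finset.abs_sum_le_sum_abs _ _).trans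
          ((Finset.sum_le_sum fun j _ => show _ ≤ N * (d * ε) by
            split_ifs
            · exact hx' j
            · rw [abs_zero]; positivity).trans (by simp))
      have h2 : d * (N * (d * ε)) ≤ 1 / N := by
        rw [le_div_iff₀ (by linarith)]
        nlinarith
      have := neg_le_of_abs_le h1
      linarith)
    (by
      rw [Finset.sum_add_distrib, Finset.sum_comm]
      simp only [Finset.sum_ite_eq, Finset.mem_univ, if_true, hx'0, add_zero]
      rw [Finset.sum_const, Finset.card_univ, nsmul_eq_mul, ← hN]
      field_simp)
    (fun i => by
      simp only [add_mul, Finset.sum_add_distrib, havg, Finset.sum_mul]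
      rw [Finset.sum_comm]
      simp only [ite_mul, zero_mul, Finset.sum_ite_eq, Finset.mem_univ, if_true]
      have := hyx' i
      simp only [hb] at this
      linarith)
  have hη : 0 ≤ N * (d * ε) := by positivity
  -- Since `y` is the image of `z` under `g`, the element `γ j * g⁻¹` carries `y` to `b j` and fixes
  -- the centroid.
  have hcol : ∀ j, HasBoundedCoords b (d * (N * (d * ε))) (fun i => b j i - s / d) := fun j => by
    have h1 := HasBoundedCoords.comp_perm_inv hdet hmax hη ⟨x', hx', hyx'⟩ (γ j * g⁻¹)
    simpa [hg, hb] using h1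
  choose a ha hab using hcol
  -- Both sides are the coordinates of `b 0 - b 1`, but entry 0 is 1 on the left and at most `1 / 2`
  -- on the right.
  have hdiff : (Pi.single (⟨0, by omega⟩ : Fin d) 1 - Pi.single (⟨1, by omega⟩ : Fin d) 1 :
      Fin d → ℝ) = a ⟨0, by omega⟩ - a ⟨1, by omega⟩ := by
    refine eq_of_sum_mul_orbit_eq hdet fun i => ?_
    have h0 := hab ⟨0, by omega⟩ i
    have h1 := hab ⟨1, by omega⟩ i
    simp only [Pi.sub_apply, sub_mul, Finset.sum_sub_distrib]
    rw [← hb] at *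
    simp only [Pi.single_apply, ite_mul, one_mul, zero_mul, Finset.sum_ite_eq', Finset.mem_univ,
      if_true]
    linarith
  have h0 := congrFun hdiff ⟨0, by omega⟩
  simp only [Pi.sub_apply, Pi.single_eq_same] at h0
  rw [Pi.single_eq_of_ne (by simp)] at h0
  have h1 := le_of_abs_le (ha ⟨0, by omega⟩ ⟨0, by omega⟩)
  have h2 := neg_le_of_abs_le (ha ⟨1, by omega⟩ ⟨0, by omega⟩)
  have h3 : d * (N * (d * ε)) ≤ 1 / 4 := by nlinarith [mul_pos (mul_pos hεpos (by positivity : (0 : ℝ) < d ^ 2)) (by linarith : 0 < N)]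
  linarith

end DetBound

/-! ### Existence of a basis of orbit points. -/

section Spanning

variable {d : ℕ} {G : Subgroup (Equiv.Perm (Fin d))} [Fintype G] {z : Fin d → ℤ}

/-- Some difference `g z - z` is nonzero with sum zero, so its orbit spans the sum-zero hyperplane;
the orbit sum supplies the constant direction because the coordinate sum of `z` is nonzero. -/
theorem IsQIGroup.span_orbit_eq_top (hG : IsQIGroup G) (hz : ∃ i j, z i ≠ z j)
    (hs : ∑ i, z i ≠ 0) :
    Submodule.span ℝ (Set.range fun (g : G) (i : Fin d) =>
      (z ((g : Equiv.Perm (Fin d))⁻¹ i) : ℝ)) = ⊤ := by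
  obtain ⟨i₀, j₀, hij⟩ := hz
  have hd : (d : ℝ) ≠ 0 := by
    have : 0 < d := i₀.pos
    positivity
  have hs' : ∑ i, (z i : ℝ) ≠ 0 := by exact_mod_cast hs
  have hN : (Fintype.card G : ℝ) ≠ 0 := by exact_mod_cast Fintype.card_ne_zero
  set U := Submodule.span ℝ (Set.range fun (g : G) (i : Fin d) =>
      (z ((g : Equiv.Perm (Fin d))⁻¹ i) : ℝ)) with hU
  have hmem : ∀ g : G, (fun i => (z ((g : Equiv.Perm (Fin d))⁻¹ i) : ℝ)) ∈ U :=
    fun g => Submodule.subset_span ⟨g, rfl⟩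
  obtain ⟨g, hg⟩ := hG.1.exists_smul_eq j₀ i₀
  have hg' : (g : Equiv.Perm (Fin d))⁻¹ i₀ = j₀ := by
    rw [← hg, Subgroup.smul_def]
    simp
  rw [eq_top_iff]
  intro w _
  set c : ℝ := (∑ i, w i) / d with hc
  obtain ⟨t, ht⟩ := hG.exists_eq_sum_orbit
    (v := fun i => z ((g : Equiv.Perm (Fin d))⁻¹ i) - z i)
    (fun h => hij (by
      have := congrFun h i₀
      rw [hg'] at this
      exact (sub_eq_zero.1 this).symm))
    (by
      rw [Finset.sum_sub_distrib, sub_eq_zero]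
      exact sum_comp_perm_inv (g : Equiv.Perm (Fin d)) z)
    (fun i => w i - c) (by
      rw [Finset.sum_sub_distrib, hc]
      simp only [Finset.sum_const, Finset.card_univ, Fintype.card_fin, nsmul_eq_mul]
      field_simp
      ring)
  have hw : w = (∑ h : G, t h • ((fun i => (z (((h * g : G) : Equiv.Perm (Fin d))⁻¹ i) : ℝ)) -
      fun i => (z ((h : Equiv.Perm (Fin d))⁻¹ i) : ℝ))) +
      (c * d / (Fintype.card G * ∑ i, (z i : ℝ))) •
        ∑ h : G, fun i => (z ((h : Equiv.Perm (Fin d))⁻¹ i) : ℝ) := by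
    funext i
    have h1 := ht i
    have h2 := sum_orbit_eq_average hG.1 z i
    simp only [Pi.add_apply, Finset.sum_apply, Pi.smul_apply, Pi.sub_apply, smul_eq_mul]
    have h3 : c * d / (Fintype.card G * ∑ i, (z i : ℝ)) *
        ∑ h : G, (z ((h : Equiv.Perm (Fin d))⁻¹ i) : ℝ) = c := by
      rw [div_mul_eq_mul_div, mul_assoc, h2]
      field_simp
    rw [h3, ← sub_eq_iff_eq_add, h1]
    refine Finset.sum_congr rfl fun h _ => ?_
    push_cast
    simp
  rw [hw]
  exact U.add_mem (U.sum_mem fun h _ => U.smul_mem _ (U.sub_mem (hmem _) (hmem _)))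
    (U.smul_mem _ (U.sum_mem fun h _ => hmem h))

theorem IsQIGroup.exists_det_orbitMatrix_ne_zero (hG : IsQIGroup G) (hz : ∃ i j, z i ≠ z j)
    (hs : ∑ i, z i ≠ 0) : ∃ γ : Fin d → G, (orbitMatrix z γ).det ≠ 0 := by
  have htop := hG.span_orbit_eq_top hz hs
  obtain ⟨f, hf, -, hli⟩ := Submodule.exists_fun_fin_finrank_span_eq ℝ
    (Set.range fun (g : G) (i : Fin d) => (z ((g : Equiv.Perm (Fin d))⁻¹ i) : ℝ))
  have hrank : d = Module.finrank ℝ (Submodule.span ℝ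
      (Set.range fun (g : G) (i : Fin d) => (z ((g : Equiv.Perm (Fin d))⁻¹ i) : ℝ))) := by
    rw [htop, finrank_top, Module.finrank_fintype_fun_eq_card, Fintype.card_fin]
  choose γ hγ using fun j => hf (Fin.cast hrank j)
  refine ⟨γ, fun h0 => ?_⟩
  have hunit : IsUnit ((orbitMatrix z γ).map (Int.castRingHom ℝ)) := by
    rw [← Matrix.linearIndependent_cols_iff_isUnit]
    have hcol : ((orbitMatrix z γ).map (Int.castRingHom ℝ)).col = f ∘ Fin.cast hrank :=
      funext hγ
    rw [hcol]
    exact hli.comp (Fin.cast hrank) (Fin.cast_injective hrank)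
  rw [Matrix.isUnit_iff_isUnit_det, ← RingHom.mapMatrix_apply, ← RingHom.map_det, h0] at hunit
  simp at hunit

theorem IsQIGroup.exists_maximal_det_orbitMatrix (hG : IsQIGroup G) (hz : ∃ i j, z i ≠ z j)
    (hs : ∑ i, z i ≠ 0) : ∃ γ : Fin d → G, (orbitMatrix z γ).det ≠ 0 ∧
      ∀ γ' : Fin d → G, |(orbitMatrix z γ').det| ≤ |(orbitMatrix z γ).det| := by
  obtain ⟨γ₀, h₀⟩ := hG.exists_det_orbitMatrix_ne_zero hz hs
  obtain ⟨γ, hγ⟩ := @Finite.exists_max (Fin d → G) ℤ _ ⟨γ₀⟩ _ fun γ => |(orbitMatrix z γ).det|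
  exact ⟨γ, abs_pos.1 ((abs_pos.2 h₀).trans_le (hγ γ₀)), hγ⟩

end Spanning

/-! ### Constructing normalizer equivalences. -/

section Equivalence

variable {d : ℕ} {G : Subgroup (Equiv.Perm (Fin d))} {z z' : Fin d → ℤ}

theorem normalizerEquivalent_add_const (z : Fin d → ℤ) (t : ℤ) :
    NormalizerEquivalent (permutationMatrices G) z (fun i => z i + t) := by
  refine ⟨1, one_mem _, fun _ => t, ?_, ?_⟩
  · rw [latticePoint_mem_fixedSpace]
    intro A hA
    obtain ⟨g, rfl⟩ := mem_permutationMatrices_iff.1 hA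
    rw [permGL_mulVec]
    rfl
  · funext i
    simp

/-- Two lattice points are related by a matrix of determinant one in the centralizer of `G` when
their orbit matrices agree modulo their common determinant and their orbits satisfy the same linear
relations. -/
theorem normalizerEquivalent_of_orbitMatrix (γ : Fin d → G) (hdet : (orbitMatrix z γ).det ≠ 0)
    (hdet' : (orbitMatrix z' γ).det = (orbitMatrix z γ).det)
    (hmod : ∀ i j, orbitMatrix z' γ i j ≡ orbitMatrix z γ i j [ZMOD (orbitMatrix z γ).det])
    (hcoef : ∀ g : G, (orbitMatrix z' γ).cramer (z' ∘ ⇑(g : Equiv.Perm (Fin d))⁻¹) =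
      (orbitMatrix z γ).cramer (z ∘ ⇑(g : Equiv.Perm (Fin d))⁻¹)) :
    NormalizerEquivalent (permutationMatrices G) z z' := by
  set A := orbitMatrix z γ with hA
  set A' := orbitMatrix z' γ with hA'
  choose E hE using fun i j => (hmod i j).symm.dvd
  set F : Matrix (Fin d) (Fin d) ℤ := Matrix.of E with hF
  have hAF : A' = A + A.det • F := by
    ext i j
    have := hE i j
    simp only [Matrix.add_apply, Matrix.smul_apply, smul_eq_mul, hF, Matrix.of_apply]
    linarith
  -- This is `A' * A⁻¹`; the congruence modulo `A.det` cancels the denominator of `A⁻¹`.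
  set S : Matrix (Fin d) (Fin d) ℤ := 1 + F * A.adjugate with hS
  have hSA : S * A = A' := by
    rw [hS, add_mul, one_mul, mul_assoc, Matrix.adjugate_mul, hAF, mul_smul_comm, mul_one]
  have hSdet : S.det = 1 := by
    have := congrArg Matrix.det hSA
    rw [Matrix.det_mul, hdet'] at this
    exact mul_right_cancel₀ hdet (by rw [this, one_mul])
  have horbit : ∀ g : G, S.mulVec (z ∘ ⇑(g : Equiv.Perm (Fin d))⁻¹) =
      z' ∘ ⇑(g : Equiv.Perm (Fin d))⁻¹ := by
    intro g
    have h1 := Matrix.mulVec_cramer A (z ∘ ⇑(g : Equiv.Perm (Fin d))⁻¹)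
    have h2 := Matrix.mulVec_cramer A' (z' ∘ ⇑(g : Equiv.Perm (Fin d))⁻¹)
    rw [hcoef, hdet', ← hSA, ← Matrix.mulVec_mulVec, h1, Matrix.mulVec_smul] at h2
    exact smul_right_injective _ hdet h2
  have hunit : IsUnit S.det := by rw [hSdet]; exact isUnit_one
  set T : GL (Fin d) ℤ := Matrix.GeneralLinearGroup.mk'' S hunit with hT
  have hTS : (T : Matrix (Fin d) (Fin d) ℤ) = S := rfl
  -- It suffices to compare on the columns of `A`: both products send `γ j z` to `(h * γ j) z'`.
  have hcomm : ∀ h : G, T * permGL (h : Equiv.Perm (Fin d)) =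
      permGL (h : Equiv.Perm (Fin d)) * T := by
    intro h
    set P : Matrix (Fin d) (Fin d) ℤ :=
      ((permGL (h : Equiv.Perm (Fin d)) : GL (Fin d) ℤ) : Matrix (Fin d) (Fin d) ℤ) with hP
    have hcol : S * P * A = P * S * A := by
      have : ∀ j, (S * P * A).col j = (P * S * A).col j := by
        intro j
        have hAj : A.col j = z ∘ ⇑(γ j : Equiv.Perm (Fin d))⁻¹ := rfl
        rw [← Matrix.mulVec_single_one, ← Matrix.mulVec_single_one, ← Matrix.mulVec_mulVec,
          ← Matrix.mulVec_mulVec, ← Matrix.mulVec_mulVec, ← Matrix.mulVec_mulVec,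
          Matrix.mulVec_single_one, hAj, horbit, hP, permGL_mulVec, permGL_mulVec]
        exact horbit (h * γ j)
      ext i j
      exact congrFun (this j) i
    have h3 : A.det • (S * P) = A.det • (P * S) := by
      have := congrArg (· * A.adjugate) hcol
      simpa only [mul_assoc, Matrix.mul_adjugate, mul_smul_comm, mul_one] using this
    exact Units.ext (smul_right_injective _ hdet h3)
  refine ⟨T, ?_, 0, ?_, ?_⟩
  · rw [Subgroup.mem_normalizer_iff]
    intro B
    have hconj : ∀ B ∈ permutationMatrices G, T * B * T⁻¹ = B := by
      intro B hB
      obtain ⟨h, rfl⟩ := mem_permutationMatrices_iff.1 hB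
      rw [hcomm, mul_inv_cancel_right]
    constructor
    · intro hB
      rwa [hconj B hB]
    · intro hB
      have h1 := hconj _ hB
      have h2 : T * B * T⁻¹ = B := by
        have := congrArg (fun X => T⁻¹ * X * T) h1
        simpa [mul_assoc] using this
      rwa [h2] at hB
  · rw [latticePoint_mem_fixedSpace]
    intro B _
    rw [Matrix.mulVec_zero]
  · rw [add_zero, hTS]
    exact (horbit 1).symm

end Equivalence

/-! ### Transitive groups of prime degree. -/

section PrimeDegree

variable {d : ℕ}

/-- Orbit-stabilizer gives that `d` divides the group order, and Cauchy's theorem applies. -/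
theorem exists_orderOf_eq_of_isPretransitive (hd : d.Prime) (G : Subgroup (Equiv.Perm (Fin d)))
    (hG : MulAction.IsPretransitive G (Fin d)) : ∃ g : G, orderOf g = d := by
  have : Fact d.Prime := ⟨hd⟩
  have h1 := MulAction.index_stabilizer_of_transitive G (⟨0, hd.pos⟩ : Fin d)
  rw [Nat.card_eq_fintype_card, Fintype.card_fin] at h1
  exact exists_prime_orderOf_dvd_card' d (h1.symm.dvd.trans (Subgroup.index_dvd_card _))

theorem exists_pow_apply_eq_of_orderOf_eq (hd : d.Prime) {σ : Equiv.Perm (Fin d)}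
    (hσ : orderOf σ = d) (i j : Fin d) : ∃ k < d, (σ ^ k) i = j := by
  have hcyc : σ.IsCycle := Equiv.Perm.isCycle_of_prime_order'' (by simpa using hd) (by simpa)
  have hsupp : σ.support = Finset.univ :=
    Finset.eq_univ_of_card _ (by rw [← hcyc.orderOf, hσ, Fintype.card_fin])
  have hne : ∀ k, σ k ≠ k := fun k => Equiv.Perm.mem_support.1 (hsupp ▸ Finset.mem_univ k)
  obtain ⟨k, hk⟩ := hcyc.exists_pow_eq (hne i) (hne j)
  exact ⟨k % d, Nat.mod_lt _ hd.pos, by rw [← hk, ← pow_mod_orderOf σ k, hσ]⟩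

open Polynomial in
-- The cyclotomic polynomial is irreducible of degree `d - 1`. If it divided `P`, then `P` would be
-- a nonzero constant multiple of it, but its value at 1 is `d`.
theorem isCoprime_cyclotomic_of_eval_one_eq_zero (hd : d.Prime) {P : ℚ[X]} (hP : P ≠ 0)
    (hdeg : P.natDegree < d) (h1 : P.eval 1 = 0) : IsCoprime P (cyclotomic d ℚ) := by
  have : Fact d.Prime := ⟨hd⟩
  refine ((cyclotomic.irreducible_rat hd.pos).coprime_iff_not_dvd.2 ?_).symm
  rintro ⟨R, rfl⟩
  have hR : R ≠ 0 := right_ne_zero_of_mul hP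
  rw [natDegree_mul (cyclotomic_ne_zero d ℚ) hR, natDegree_cyclotomic, Nat.totient_prime hd] at hdeg
  have hR0 : R.natDegree = 0 := by have := hd.pos; omega
  rw [eq_C_of_natDegree_eq_zero hR0] at h1 hR
  rw [eval_mul, eval_one_cyclotomic_prime, eval_C] at h1
  refine hR ?_
  rw [(mul_eq_zero.1 h1).resolve_left (by exact_mod_cast hd.ne_zero), C_0]

theorem aeval_apply_mem_of_forall_apply_mem {R M : Type*} [CommSemiring R] [AddCommMonoid M]
    [Module R M] {T : Module.End R M} {U : Submodule R M} (hT : ∀ u ∈ U, T u ∈ U)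
    (f : Polynomial R) {u : M} (hu : u ∈ U) : Polynomial.aeval T f u ∈ U := by
  have hpow : ∀ n : ℕ, (T ^ n) u ∈ U := by
    intro n
    induction n with
    | zero => simpa
    | succ n ih => rw [pow_succ', Module.End.mul_apply]; exact hT _ ih
  induction f using Polynomial.induction_on' with
  | add p q hp hq => rw [map_add, LinearMap.add_apply]; exact U.add_mem hp hq
  | monomial n a =>
    rw [Polynomial.aeval_monomial, Module.End.mul_apply, Module.algebraMap_end_apply]
    exact U.smul_mem _ (hpow n)

theorem realAction_permGL_pow_single (σ : Equiv.Perm (Fin d)) (n : ℕ) (i : Fin d) :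
    ((realAction (permGL σ) : Module.End ℝ (EuclideanSpace ℝ (Fin d))) ^ n)
      (EuclideanSpace.single i 1) = EuclideanSpace.single ((σ ^ n) i) 1 := by
  induction n with
  | zero => simp
  | succ n ih =>
    rw [pow_succ', Module.End.mul_apply, ih, realAction_permGL]
    ext k
    simp only [Function.comp_apply, PiLp.single_apply, pow_succ', Equiv.Perm.mul_apply,
      Equiv.Perm.inv_eq_iff_eq]

theorem eq_sum_smul_single (v : EuclideanSpace ℝ (Fin d)) :
    v = ∑ i, v i • EuclideanSpace.single i (1 : ℝ) := by
  ext k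
  simp [Pi.single_apply]

open Polynomial in
/-- The cyclic shifts of a nonzero rational vector of prime length with coordinate sum zero span
all vectors with coordinate sum zero. -/
theorem mem_of_rational_mem_of_orderOf_eq (hd : d.Prime) {σ : Equiv.Perm (Fin d)}
    (hσ : orderOf σ = d) {U : Submodule ℝ (EuclideanSpace ℝ (Fin d))}
    (hU : ∀ u ∈ U, realAction (permGL σ) u ∈ U) {v : EuclideanSpace ℝ (Fin d)} (hv : v ∈ U)
    (hv0 : v ≠ 0) (hvs : ∑ i, v i = 0) (hvq : ∀ i, ∃ q : ℚ, v i = q)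
    {w : EuclideanSpace ℝ (Fin d)} (hw : ∑ i, w i = 0) : w ∈ U := by
  have : Fact d.Prime := ⟨hd⟩
  set T : Module.End ℝ (EuclideanSpace ℝ (Fin d)) := realAction (permGL σ) with hT
  set i₀ : Fin d := ⟨0, hd.pos⟩
  set e : EuclideanSpace ℝ (Fin d) := EuclideanSpace.single i₀ 1 with he
  have hTe : ∀ n, (T ^ n) e = EuclideanSpace.single ((σ ^ n) i₀) 1 := fun n =>
    realAction_permGL_pow_single σ n i₀
  choose q hq using hvq
  choose k hk hki using exists_pow_apply_eq_of_orderOf_eq hd hσ i₀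
  -- The cycle identifies `ℝ^d` with `ℝ[X] / (X ^ d - 1)`, so `v` becomes `P(T) e`, and its zero
  -- coordinate sum becomes `P(1) = 0`.
  set P : ℚ[X] := ∑ i, monomial (k i) (q i) with hP
  have hPv : aeval T (P.map (algebraMap ℚ ℝ)) e = v := by
    rw [eq_sum_smul_single v, hP, Polynomial.map_sum, map_sum, LinearMap.sum_apply]
    refine Finset.sum_congr rfl fun i _ => ?_
    rw [map_monomial, aeval_monomial, Module.End.mul_apply, Module.algebraMap_end_apply, hTe,
      hki, hq, eq_ratCast]
  have hP0 : P ≠ 0 := by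
    intro h
    rw [h] at hPv
    exact hv0 (by simpa using hPv.symm)
  have hPdeg : P.natDegree < d := by
    refine lt_of_le_of_lt (natDegree_sum_le_of_forall_le _ _ (n := d - 1) fun i _ => ?_)
      (Nat.sub_lt hd.pos one_pos)
    have := hk i
    exact (natDegree_monomial_le _).trans (by omega)
  have hP1 : P.eval 1 = 0 := by
    have h1 : ((∑ i, q i : ℚ) : ℝ) = 0 := by
      push_cast
      rw [← hvs, Finset.sum_congr rfl fun i _ => hq i]
    rw [hP, eval_finsetSum]
    simpa using (by exact_mod_cast h1 : ∑ i, q i = 0)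
  obtain ⟨a, b, hab⟩ := (isCoprime_cyclotomic_of_eval_one_eq_zero hd hP0 hPdeg hP1).map
    (mapRingHom (algebraMap ℚ ℝ))
  simp only [coe_mapRingHom, map_cyclotomic] at hab
  have hσd : σ ^ d = 1 := by
    have := pow_orderOf_eq_one σ
    rwa [hσ] at this
  have hdiff : T e - e ∈ U := by
    -- The Bézout identity times `X - 1`; the last term kills `e`, as `T ^ d` fixes it.
    have h1 : (X - 1 : ℝ[X]) = (X - 1) * a * P.map (algebraMap ℚ ℝ) + b * (X ^ d - 1) := by
      rw [← cyclotomic_prime_mul_X_sub_one]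
      linear_combination -(X - 1) * hab
    have h2 := congrArg (fun f => aeval T f e) h1
    simp only [map_add, map_mul _ _ (P.map (algebraMap ℚ ℝ)), map_mul _ b, LinearMap.add_apply,
      Module.End.mul_apply, hPv] at h2
    have h3 : aeval T (X ^ d - 1 : ℝ[X]) e = 0 := by
      simp only [map_sub, map_pow, aeval_X, map_one, LinearMap.sub_apply, Module.End.one_apply, hTe]
      rw [hσd, Equiv.Perm.one_apply, sub_self]
    rw [h3, map_zero, add_zero] at h2
    have h4 : aeval T (X - 1 : ℝ[X]) e = T e - e := by simp
    rw [← h4, h2]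
    exact aeval_apply_mem_of_forall_apply_mem hU _ hv
  have hpow : ∀ n, (T ^ n) e - e ∈ U := by
    intro n
    induction n with
    | zero => simp
    | succ n ih =>
      have h1 : (T ^ (n + 1)) e - e = T ((T ^ n) e - e) + (T e - e) := by
        rw [pow_succ', Module.End.mul_apply, map_sub]
        abel
      rw [h1]
      exact U.add_mem (hU _ ih) hdiff
  have hw' : w = ∑ i, w i • (EuclideanSpace.single i (1 : ℝ) - e) := by
    simp only [smul_sub, Finset.sum_sub_distrib]
    rw [← eq_sum_smul_single, ← Finset.sum_smul, hw, zero_smul, sub_zero]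
  rw [hw']
  refine U.sum_mem fun i _ => U.smul_mem _ ?_
  have := hpow (k i)
  rwa [hTe, hki] at this

theorem isQIGroup_of_prime (hd : d.Prime) (G : Subgroup (Equiv.Perm (Fin d)))
    (hG : MulAction.IsPretransitive G (Fin d)) : IsQIGroup G := by
  refine ⟨hG, fun U hUW hrat hinv => or_iff_not_imp_left.2 fun hU0 => le_antisymm hUW ?_⟩
  obtain ⟨g, hg⟩ := exists_orderOf_eq_of_isPretransitive hd G hG
  obtain ⟨s, -, hspan, hs⟩ := hrat
  have hex : ∃ v ∈ s, v ≠ 0 := by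
    by_contra! h
    exact hU0 (by rw [← hspan, Submodule.span_eq_bot]; exact h)
  obtain ⟨v, hvs, hv0⟩ := hex
  have hvU : v ∈ U := hspan ▸ Submodule.subset_span hvs
  intro w hw
  rw [mem_orthogonal_fixedSpace_iff hG] at hw
  exact mem_of_rational_mem_of_orderOf_eq hd ((Subgroup.orderOf_coe g).trans hg)
    (hinv _ (permGL_mem g)) hvU hv0 ((mem_orthogonal_fixedSpace_iff hG v).1 (hUW hvU)) (hs v hvs) hw

end PrimeDegree

/-! ### Finitely many classes of core points. -/

section Finiteness

variable {d : ℕ} {G : Subgroup (Equiv.Perm (Fin d))}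

/-- The shape of a lattice point: a choice of orbit points forming a basis, their determinant,
their residues modulo the determinant, and the coordinates of the orbit in that basis, cleared of
denominators. -/
def HasOrbitShape (z : Fin d → ℤ)
    (c : (Fin d → G) × ℤ × (Fin d → Fin d → ℤ) × (G → Fin d → ℤ)) : Prop :=
  (orbitMatrix z c.1).det ≠ 0 ∧ (orbitMatrix z c.1).det = c.2.1 ∧
    (∀ i j, orbitMatrix z c.1 i j % (orbitMatrix z c.1).det = c.2.2.1 i j) ∧
      ∀ g : G, (orbitMatrix z c.1).cramer (z ∘ ⇑(g : Equiv.Perm (Fin d))⁻¹) = c.2.2.2 g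

theorem HasOrbitShape.normalizerEquivalent {z z' : Fin d → ℤ}
    {c : (Fin d → G) × ℤ × (Fin d → Fin d → ℤ) × (G → Fin d → ℤ)} (h : HasOrbitShape z c)
    (h' : HasOrbitShape z' c) : NormalizerEquivalent (permutationMatrices G) z z' := by
  obtain ⟨hdet, hD, hmod, hcoef⟩ := h
  obtain ⟨-, hD', hmod', hcoef'⟩ := h'
  have hDD := hD'.trans hD.symm
  refine normalizerEquivalent_of_orbitMatrix c.1 hdet hDD (fun i j => ?_)
    fun g => (hcoef' g).trans (hcoef g).symm
  rw [Int.ModEq, hmod i j, ← hmod' i j, hDD]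

theorem exists_add_const_sum_mem_Icc (hd : 0 < d) (z : Fin d → ℤ) :
    ∃ t : ℤ, 1 ≤ ∑ i, (z i + t) ∧ ∑ i, (z i + t) ≤ d := by
  have hd' : (0 : ℤ) < d := by exact_mod_cast hd
  -- The shift by 1 puts the residue in `1, ..., d`, avoiding a sum of 0, for which the orbit could
  -- not span.
  refine ⟨-((∑ i, z i - 1) / d), ?_⟩
  have h1 := Int.emod_add_mul_ediv (∑ i, z i - 1) d
  have h2 := Int.emod_nonneg (∑ i, z i - 1) hd'.ne'
  have h3 := Int.emod_lt_of_pos (∑ i, z i - 1) hd'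
  rw [Finset.sum_add_distrib]
  simp only [Finset.sum_const, Finset.card_univ, Fintype.card_fin, nsmul_eq_mul, mul_neg]
  constructor <;> linarith

/-- The determinant bound controls everything: residues lie below `|D|`, and Cramer coefficients are
determinants of orbit matrices, hence at most `|D|` in absolute value. -/
theorem IsQIGroup.exists_finite_orbitShapes (hG : IsQIGroup G) :
    ∃ F : Set ((Fin d → G) × ℤ × (Fin d → Fin d → ℤ) × (G → Fin d → ℤ)), F.Finite ∧
      ∀ z, IsCorePoint (permutationMatrices G) z → (∃ i j, z i ≠ z j) →
        ∃ c ∈ F, ∃ t : ℤ, HasOrbitShape (fun i => z i + t) c := by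
  have := Fintype.ofFinite G
  obtain ⟨C, hC⟩ := exists_nat_gt ((4 * (d : ℝ) ^ 2 * (Fintype.card G : ℝ) ^ 2) ^ d)
  set B : Set (ℤ × (Fin d → Fin d → ℤ) × (G → Fin d → ℤ)) :=
    Set.Icc (-(C : ℤ), fun _ _ => 0, fun _ _ => -(C : ℤ)) ((C : ℤ), fun _ _ => C, fun _ _ => C)
    with hB
  have hBfin : B.Finite := by
    rw [hB, ← Set.Icc_prod_Icc, ← Set.Icc_prod_Icc]
    exact (Set.finite_Icc _ _).prod ((Set.finite_Icc _ _).prod (Set.finite_Icc _ _))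
  refine ⟨Set.univ ×ˢ B, Set.finite_univ.prod hBfin, ?_⟩
  intro z hz hne
  have hd : 2 ≤ d := by
    obtain ⟨i, j, hij⟩ := hne
    by_contra! h
    have : i = j := by ext; omega
    exact hij (by rw [this])
  obtain ⟨t, ht1, htd⟩ := exists_add_const_sum_mem_Icc (by omega : 0 < d) z
  obtain ⟨γ, hdet, hmax⟩ := hG.exists_maximal_det_orbitMatrix (z := fun i => z i + t)
    (by simpa using hne) (by linarith)
  have hlt := (abs_det_orbitMatrix_lt hG hd (hz.hasOnlyOrbitPoints.add_const t) ht1 htd hdet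
    hmax).trans hC
  have hD : |(orbitMatrix (fun i => z i + t) γ).det| ≤ C := by exact_mod_cast hlt.le
  have hcr : ∀ (g : G) j, |(orbitMatrix (fun i => z i + t) γ).cramer
      ((fun i => z i + t) ∘ ⇑(g : Equiv.Perm (Fin d))⁻¹) j| ≤ C := fun g j => by
    rw [cramer_orbitMatrix]
    exact (hmax _).trans hD
  refine ⟨(γ, (orbitMatrix (fun i => z i + t) γ).det,
    fun i j => orbitMatrix (fun i => z i + t) γ i j % (orbitMatrix (fun i => z i + t) γ).det,
    fun g => (orbitMatrix (fun i => z i + t) γ).cramer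
      ((fun i => z i + t) ∘ ⇑(g : Equiv.Perm (Fin d))⁻¹)), ⟨Set.mem_univ _, ?_⟩, t, hdet, rfl,
    fun _ _ => rfl, fun _ => rfl⟩
  refine ⟨⟨(abs_le.1 hD).1, fun i j => Int.emod_nonneg _ hdet, fun g j => (abs_le.1 (hcr g j)).1⟩,
    (abs_le.1 hD).2, fun i j => (Int.emod_lt_abs _ hdet).le.trans hD,
    fun g j => (abs_le.1 (hcr g j)).2⟩

theorem normalizerEquivalent_of_forall_eq {z z' : Fin d → ℤ} (hz : ∀ i j, z i = z j)
    (hz' : ∀ i j, z' i = z' j) : NormalizerEquivalent (permutationMatrices G) z z' := by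
  rcases isEmpty_or_nonempty (Fin d) with he | ⟨⟨i₀⟩⟩
  · rw [Subsingleton.elim z' z]
    exact (normalizerEquivalent_equivalence _).refl z
  · have h := normalizerEquivalent_add_const (G := G) z (z' i₀ - z i₀)
    have h1 : (fun i => z i + (z' i₀ - z i₀)) = z' := funext fun i => by
      rw [hz i i₀, hz' i i₀]
      ring
    rwa [h1] at h

theorem IsQIGroup.finite_quotient_corePointSetoid (hG : IsQIGroup G) :
    Finite (Quotient (corePointSetoid (permutationMatrices G))) := by
  classical
  obtain ⟨F, hF, hcore⟩ := hG.exists_finite_orbitShapes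
  have hFfin : Finite F := hF
  -- The value `none` marks constant points, whose orbits do not span when `d ≥ 2`. The resulting
  -- label of a chosen representative is injective on classes.
  have hex : ∀ z : {z : Fin d → ℤ // IsCorePoint (permutationMatrices G) z},
      ∃ o : Option F, match o with
        | none => ∀ i j, z.1 i = z.1 j
        | some c => ∃ t : ℤ, HasOrbitShape (fun i => z.1 i + t) c.1 := by
    intro z
    by_cases h : ∀ i j, z.1 i = z.1 j
    · exact ⟨none, h⟩
    · push Not at h
      obtain ⟨c, hc, ht⟩ := hcore z.1 z.2 h
      exact ⟨some ⟨c, hc⟩, ht⟩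
  choose o ho using hex
  refine Finite.of_injective (fun x => o x.out) fun x y hxy => ?_
  rw [← Quotient.out_eq x, ← Quotient.out_eq y]
  refine Quotient.sound ?_
  change NormalizerEquivalent (permutationMatrices G) x.out.1 y.out.1
  have hx := ho x.out
  have hy := ho y.out
  simp only at hxy
  rw [hxy] at hx
  have heq := normalizerEquivalent_equivalence (permutationMatrices G)
  rcases h : o y.out with _ | c
  · rw [h] at hx hy
    exact normalizerEquivalent_of_forall_eq hx hy
  · rw [h] at hx hy
    obtain ⟨t, ht⟩ := hx
    obtain ⟨t', ht'⟩ := hy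
    exact heq.trans (normalizerEquivalent_add_const _ t) (heq.trans
      (ht.normalizerEquivalent ht') (heq.symm (normalizerEquivalent_add_const _ t')))

end Finiteness

theorem theorem5p1 (d : ℕ) :
    (∀ G : Subgroup (Equiv.Perm (Fin d)), IsQIGroup G →
      (∃ M : ℝ, ∀ z : Fin d → ℤ, IsCorePoint (permutationMatrices G) z →
        ∃ w : Fin d → ℤ, IsCorePoint (permutationMatrices G) w ∧
          NormalizerEquivalent (permutationMatrices G) z w ∧ ‖latticePoint w‖ ^ 2 ≤ M) ∧
      Finite (Quotient (corePointSetoid (permutationMatrices G)))) ∧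
    (d.Prime → ∀ G : Subgroup (Equiv.Perm (Fin d)),
      MulAction.IsPretransitive G (Fin d) → IsQIGroup G) := by
  refine ⟨fun G hG => ?_, isQIGroup_of_prime⟩
  have hfin := hG.finite_quotient_corePointSetoid
  refine ⟨?_, hfin⟩
  obtain ⟨M, hM⟩ := (Set.finite_range fun x : Quotient (corePointSetoid (permutationMatrices G)) =>
    ‖latticePoint x.out.1‖ ^ 2).bddAbove
  refine ⟨M, fun z hz => ?_⟩
  set x : Quotient (corePointSetoid (permutationMatrices G)) := Quotient.mk _ ⟨z, hz⟩
  exact ⟨x.out.1, x.out.2,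
    (normalizerEquivalent_equivalence _).symm (Quotient.mk_out (s := corePointSetoid _) ⟨z, hz⟩),
    hM ⟨x, rfl⟩⟩
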